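/- Let $n\ge 3$ and let $G$ be a finite simple connected graph with $N_0$ vertices and $E_0$ edges. The clique-blew up graph $CL(G)$ is obtained from $G$ by adding, for every edge $e$ of $G$, $n-2$ new vertices and joining them to each other and to both end-vertices of $e$, so that they form together with the end-vertices of $e$ a complete graph $K_n$ (the new vertices of different edges being distinct). Put $CL_0(G)=G$ and $CL_r(G)=CL(CL_{r-1}(G))$ for $r\ge 1$, and let $\tau(H)$ denote the number of (labelled) spanning trees of a graph $H$. **Theorem.** One has $$\tau(CL(G))=2^{E_0-N_0+1}\cdot n^{(n-3)E_0+N_0-1}\cdot\tau(G),$$ and for every $r\ge 1$ $$\tau(CL_r(G))=2^{\,2E_0\alpha-rN_0-\frac{2E_0}{n+1}(2\alpha-r)+r}\cdot n^{\,2(n-3)E_0\alpha+rN_0+\frac{2E_0}{n+1}(2\alpha-r)-r}\cdot\tau(G),$$ where $$\alpha=\frac{\frac{n^r(n-1)^r}{2^r}-1}{n^2-n-2}.$$ -/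

import Mathlib

universe u

/-- The clique that replaces the edge `e` of `G`: the two end-vertices of `e` together with
the `n - 2` new vertices belonging to `e`. -/
def edgeClique (n : ℕ) {V : Type u} (G : SimpleGraph V) (e : G.edgeSet) :
    Set (V ⊕ (G.edgeSet × Fin (n - 2))) :=
  {x | (∃ v : V, v ∈ (e : Sym2 V) ∧ x = Sum.inl v) ∨ (∃ i : Fin (n - 2), x = Sum.inr (e, i))}

/-- The clique-blew up graph `CL(G)` with parameter `n`: for every edge `e` of `G`, `n - 2` new
vertices are added, and they form, together with the end-vertices of `e`, a complete graph
on `n` vertices. There are no other edges. -/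
def cliqueBlowUp (n : ℕ) {V : Type u} (G : SimpleGraph V) :
    SimpleGraph (V ⊕ (G.edgeSet × Fin (n - 2))) where
  Adj x y := x ≠ y ∧ ∃ e : G.edgeSet, x ∈ edgeClique n G e ∧ y ∈ edgeClique n G e
  symm := ⟨fun _ _ h => ⟨h.1.symm, h.2.imp fun _ he => ⟨he.2, he.1⟩⟩⟩
  loopless := ⟨fun _ h => h.1 rfl⟩

/-- The iterated clique-blew up graph `CL_r(G)`, bundled with its vertex type:
`CL_0(G) = G` and `CL_{r+1}(G) = CL(CL_r(G))`. -/
def iterCliqueBlowUp (n : ℕ) {V : Type u} (G : SimpleGraph V) :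
    ℕ → (W : Type u) × SimpleGraph W
  | 0 => ⟨V, G⟩
  | r + 1 => ⟨_, cliqueBlowUp n (iterCliqueBlowUp n G r).2⟩

/-- The number `τ(G)` of spanning trees of `G`: trees on the whole vertex set all of whose
edges are edges of `G`. -/
noncomputable def numSpanningTrees {V : Type u} (G : SimpleGraph V) : ℕ :=
  Nat.card {T : SimpleGraph V // T ≤ G ∧ T.IsTree}

/-! The count is a Laplacian determinant from which the new vertices are eliminated. The matrix tree
theorem `numSpanningTrees_eq_det` comes from expanding the reduced Laplacian row by row: each choice
of one neighbour per non-root vertex contributes 1 if following the choices always leads to the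
root, and 0 otherwise; the surviving choices are the rooted spanning trees.

In the reduced Laplacian of `CL(G)`, rooted at an old vertex, the new vertices form one block `n • 1
- J` of size `n - 2` per edge (`J` is the all-ones matrix), with determinant `n ^ (n - 2) * (2 /
n)`. The Schur complement of these blocks is `n / 2` times the reduced Laplacian of `G`
(`det_lapMatrix_cliqueBlowUp`), which gives the one-step formula. The iterated formula follows by
induction from the edge and vertex recursions. -/

/-- A function `f`, read as assigning a parent to every vertex other than the root `r`, is
acyclic if it decreases some height function. -/
def IsAcyclicParent {V : Type u} {r : V} (f : {v : V // v ≠ r} → V) : Prop :=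
  ∃ h : V → ℕ, ∀ v, h (f v) < h v

/-- The graph whose edges join every non-root vertex to its parent. -/
def parentGraph {V : Type u} {r : V} (f : {v : V // v ≠ r} → V) : SimpleGraph V :=
  SimpleGraph.fromRel fun a b => ∃ h : a ≠ r, f ⟨a, h⟩ = b

/-! ### Rooted trees and acyclic parent functions. -/

section ParentGraph

variable {V : Type u} {r : V} {f : {v : V // v ≠ r} → V}

theorem IsAcyclicParent.ne (hf : IsAcyclicParent f) (v : {v : V // v ≠ r}) : (v : V) ≠ f v := by
  obtain ⟨h, hh⟩ := hf
  intro e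
  exact (hh v).ne (congrArg h e.symm)

theorem IsAcyclicParent.adj (hf : IsAcyclicParent f) (v : {v : V // v ≠ r}) :
    (parentGraph f).Adj v (f v) :=
  (SimpleGraph.fromRel_adj _ _ _).2 ⟨hf.ne v, Or.inl ⟨v.2, rfl⟩⟩

theorem parentGraph_le {G : SimpleGraph V} (h : ∀ v : {v : V // v ≠ r}, G.Adj v (f v)) :
    parentGraph f ≤ G := by
  intro a b hab
  rcases ((SimpleGraph.fromRel_adj _ _ _).1 hab).2 with ⟨ha, rfl⟩ | ⟨hb, rfl⟩
  · exact h ⟨a, ha⟩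
  · exact (h ⟨b, hb⟩).symm

/-- Following parents is a path to the root. -/
theorem IsAcyclicParent.exists_isPath (hf : IsAcyclicParent f) (v : V) :
    ∃ p : (parentGraph f).Walk v r, p.IsPath ∧ ∀ hv : v ≠ r, p.snd = f ⟨v, hv⟩ := by
  obtain ⟨h, hh⟩ := id hf
  -- The height bound along the path is what keeps `v` off the path of its parent.
  suffices H : ∀ n v, h v = n → ∃ p : (parentGraph f).Walk v r, p.IsPath ∧
      (∀ x ∈ p.support, h x ≤ h v) ∧ ∀ hv : v ≠ r, p.snd = f ⟨v, hv⟩ by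
    obtain ⟨p, h1, -, h2⟩ := H _ v rfl
    exact ⟨p, h1, h2⟩
  intro n
  induction n using Nat.strong_induction_on with
  | _ n ih =>
    intro v hv
    by_cases hr : v = r
    · subst hr
      exact ⟨.nil, by simp, by simp, fun hv => (hv rfl).elim⟩
    · obtain ⟨p, hp, hs, -⟩ := ih _ (hv ▸ hh ⟨v, hr⟩) _ rfl
      refine ⟨.cons (hf.adj ⟨v, hr⟩) p, ?_, ?_, fun _ => by simp⟩
      · rw [SimpleGraph.Walk.cons_isPath_iff]
        exact ⟨hp, fun hmem => (hh ⟨v, hr⟩).not_ge (hs _ hmem)⟩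
      · intro x hx
        rw [SimpleGraph.Walk.support_cons, List.mem_cons] at hx
        rcases hx with rfl | hx
        · exact le_rfl
        · exact (hs x hx).trans (hh ⟨v, hr⟩).le

theorem IsAcyclicParent.connected (hf : IsAcyclicParent f) : (parentGraph f).Connected := by
  have key : ∀ v, (parentGraph f).Reachable v r := fun v => (hf.exists_isPath v).choose.reachable
  exact (SimpleGraph.connected_iff _).2 ⟨fun a b => (key a).trans (key b).symm, ⟨r⟩⟩

/-- Every edge comes from a non-root vertex, so a connected graph has at most `|V| - 1` edges here.
-/
theorem IsAcyclicParent.isTree [Finite V] (hf : IsAcyclicParent f) : (parentGraph f).IsTree := by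
  classical
  have := Fintype.ofFinite V
  rw [SimpleGraph.isTree_iff_connected_and_card]
  refine ⟨hf.connected, le_antisymm ?_ hf.connected.card_vert_le_card_edgeSet_add_one⟩
  have hsurj : Function.Surjective
      (fun v => ⟨s((v : V), f v), hf.adj v⟩ : {v : V // v ≠ r} → (parentGraph f).edgeSet) := by
    rintro ⟨e, he⟩
    induction e with
    | _ a b =>
      rcases ((SimpleGraph.fromRel_adj _ _ _).1 ((SimpleGraph.mem_edgeSet _).1 he)).2 with
        ⟨ha, hb⟩ | ⟨hb, ha⟩
      · exact ⟨⟨a, ha⟩, Subtype.ext (by simp [hb])⟩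
      · exact ⟨⟨b, hb⟩, Subtype.ext (by simp [ha, Sym2.eq_swap])⟩
  have h1 : Nat.card (parentGraph f).edgeSet ≤ _ := Nat.card_le_card_of_surjective _ hsurj
  have h2 : Nat.card {v : V // v ≠ r} = Nat.card V - 1 := by
    simp [Nat.card_eq_fintype_card, Fintype.card_subtype_compl]
  have h3 : 0 < Nat.card V := Nat.card_pos_iff.2 ⟨⟨r⟩, inferInstance⟩
  change Nat.card (parentGraph f).edgeSet + 1 ≤ _
  omega

/-- The parent of `v` is the second vertex on the unique path from `v` to the root. -/
theorem IsAcyclicParent.eq_of_parentGraph_eq [Finite V] {g : {v : V // v ≠ r} → V}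
    (hf : IsAcyclicParent f) (hg : IsAcyclicParent g) (h : parentGraph f = parentGraph g) :
    f = g := by
  funext v
  obtain ⟨p, hp, hp'⟩ := hf.exists_isPath v
  obtain ⟨q, hq, hq'⟩ := hg.exists_isPath v
  rw [← hp' v.2, ← hq' v.2]
  have ht := hg.isTree
  generalize parentGraph g = T at *
  subst h
  exact congrArg _ ((ht.existsUnique_path v r).unique hp hq)

/-- Every tree is the graph of an acyclic parent function. -/
theorem SimpleGraph.IsTree.exists_parentGraph_eq {T : SimpleGraph V} (hT : T.IsTree) (r : V) :
    ∃ f : {v : V // v ≠ r} → V, (∀ v : {v : V // v ≠ r}, T.Adj v (f v)) ∧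
      IsAcyclicParent f ∧ parentGraph f = T := by
  have key : ∀ v : {v : V // v ≠ r}, ∃ w, T.Adj v w ∧ T.dist w r < T.dist v r := by
    rintro ⟨v, hv⟩
    obtain ⟨p, hp⟩ := hT.1.exists_walk_length_eq_dist v r
    cases p with
    | nil => exact (hv rfl).elim
    | cons hadj q =>
      refine ⟨_, hadj, ?_⟩
      rw [← hp, SimpleGraph.Walk.length_cons]
      exact Nat.lt_succ_of_le (SimpleGraph.dist_le q)
  choose f hf hd using key
  have hac : IsAcyclicParent f := ⟨fun v => T.dist v r, hd⟩
  have hle := parentGraph_le hf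
  -- A tree is minimal among connected graphs, so its connected subgraph `parentGraph f` is all of
  -- it.
  exact ⟨f, hf, hac, le_antisymm hle
    ((SimpleGraph.isTree_iff_minimal_connected.1 hT).2 hac.connected hle)⟩

end ParentGraph

/-- Spanning trees correspond to acyclic parent functions along edges. -/
theorem numSpanningTrees_eq_card_parent {V : Type u} [Finite V] (G : SimpleGraph V) (r : V) :
    numSpanningTrees G =
      Nat.card {f : {v : V // v ≠ r} → V //
        (∀ v : {v : V // v ≠ r}, G.Adj v (f v)) ∧ IsAcyclicParent f} := by
  symm
  refine Nat.card_congr (Equiv.ofBijective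
    (fun f => ⟨parentGraph f.1, parentGraph_le f.2.1, f.2.2.isTree⟩) ⟨?_, ?_⟩)
  · intro f g h
    exact Subtype.ext (f.2.2.eq_of_parentGraph_eq g.2.2 (congrArg Subtype.val h))
  · rintro ⟨T, hle, hT⟩
    obtain ⟨f, h1, h2, h3⟩ := hT.exists_parentGraph_eq r
    exact ⟨⟨f, fun v => hle (h1 v), h2⟩, Subtype.ext h3⟩

/-! ### The matrix tree theorem. -/

/-- The reduced Laplacian of the functional graph of `f`. -/
theorem det_parent {V : Type u} [Fintype V] [DecidableEq V] {r : V}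
    (f : {v : V // v ≠ r} → V) [Decidable (IsAcyclicParent f)] :
    (Matrix.of fun v j : {v : V // v ≠ r} =>
      ((if v = j then 1 else 0) - (if f v = j then 1 else 0) : ℝ)).det =
      if IsAcyclicParent f then 1 else 0 := by
  classical
  split_ifs with hf
  · obtain ⟨h, hh⟩ := id hf
    -- Ordered by height, the matrix is block triangular with identity diagonal blocks.
    rw [Matrix.BlockTriangular.det (b := fun v : {v : V // v ≠ r} => OrderDual.toDual (h v))]
    · refine Finset.prod_eq_one fun k _ => ?_
      convert Matrix.det_one (n := {a : {v : V // v ≠ r} // OrderDual.toDual (h a) = k})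
      ext ⟨i, hi⟩ ⟨j, hj⟩
      have hne : f i ≠ j := by
        intro e
        have := hh i
        rw [e] at this
        exact this.ne (OrderDual.toDual.injective (hj.trans hi.symm))
      simp [Matrix.toSquareBlock, Matrix.toSquareBlockProp, Matrix.one_apply, hne]
    · intro i j hij
      have hij : h i < h j := hij
      have h1 : i ≠ j := by rintro rfl; exact hij.false
      have h2 : f i ≠ j := fun e => by
        have := hh i
        rw [e] at this
        exact this.not_gt hij
      simp [h1, h2]
  · rw [← Matrix.exists_mulVec_eq_zero_iff]
    let F : V → V := fun v => if h : v = r then r else f ⟨v, h⟩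
    have hF : ∀ v : {v : V // v ≠ r}, F v = f v := fun v => dif_neg v.2
    -- The indicator of the vertices that never reach the root is constant along parents, hence a
    -- kernel vector.
    let x : V → ℝ := fun v => if ∃ k, F^[k] v = r then 0 else 1
    have hx : ∀ v : {v : V // v ≠ r}, x (f v) = x v := by
      intro v
      have : (∃ k, F^[k] (f v) = r) ↔ ∃ k, F^[k] (v : V) = r := by
        rw [← hF]
        constructor
        · rintro ⟨k, hk⟩
          exact ⟨k + 1, hk⟩
        · rintro ⟨_ | k, hk⟩
          · exact (v.2 hk).elim
          · exact ⟨k, hk⟩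
      simp only [x, this]
    have hxr : x r = 0 := if_pos ⟨0, rfl⟩
    refine ⟨fun v => x v, fun h0 => hf ?_, ?_⟩
    · have hk : ∀ v : V, ∃ k, F^[k] v = r := by
        intro v
        by_cases hv : v = r
        · exact ⟨0, hv⟩
        · by_contra hc
          have := congrFun h0 ⟨v, hv⟩
          simp [x, hc] at this
      refine ⟨fun v => Nat.find (hk v), fun v => ?_⟩
      have hs := Nat.find_spec (hk v)
      rcases hn : Nat.find (hk v) with _ | k
      · rw [hn] at hs
        exact (v.2 hs).elim
      · rw [hn, Function.iterate_succ_apply, hF] at hs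
        change Nat.find _ < Nat.find (hk v)
        rw [hn]
        exact Nat.lt_succ_of_le (Nat.find_min' (hk (f v)) hs)
    · ext v
      have e : ∀ w : V, ∑ j : {v : V // v ≠ r}, (if w = j then 1 else 0) * x j = x w := by
        intro w
        by_cases hw : w = r
        · subst hw
          rw [hxr]
          exact Finset.sum_eq_zero fun j _ => by simp [j.2.symm]
        · rw [Finset.sum_eq_single ⟨w, hw⟩]
          · simp
          · intro j _ hj
            have : w ≠ j := fun h => hj (Subtype.ext h.symm)
            simp [this]
          · simp
      have e1 := e v
      simp only [Matrix.mulVec, dotProduct, Matrix.of_apply, sub_mul, Finset.sum_sub_distrib, e,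
        hx, Pi.zero_apply]
      simp only [← Subtype.ext_iff] at e1
      rw [e1, sub_self]

/-- **Matrix tree theorem**: the number of spanning trees is any principal minor of the
Laplacian obtained by deleting one vertex. -/
theorem numSpanningTrees_eq_det {V : Type u} [Fintype V] [DecidableEq V] (G : SimpleGraph V)
    [DecidableRel G.Adj] (r : V) :
    (numSpanningTrees G : ℝ) = ((G.lapMatrix ℝ).submatrix
      (Subtype.val : {v : V // v ≠ r} → V) Subtype.val).det := by
  classical
  -- Row `v` of the Laplacian is the sum over neighbours `w` of `e_v - e_w`; the determinant is
  -- multilinear in the rows.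
  let g : {v : V // v ≠ r} → V → {v : V // v ≠ r} → ℝ := fun v w j =>
    if G.Adj v w then ((if v = j then 1 else 0) - (if w = j then 1 else 0)) else 0
  have hrow : (G.lapMatrix ℝ).submatrix (Subtype.val : {v : V // v ≠ r} → V) Subtype.val =
      fun v => ∑ w, g v w := by
    ext v j
    have hg : ∀ w, g v w j = (if v = j then (if G.Adj v w then 1 else 0) else 0) -
        (if w = j then (if G.Adj v j then 1 else 0) else 0) := by
      intro w
      by_cases hw : w = j
      · subst hw
        by_cases h1 : G.Adj v j <;> simp [g, h1]
      · by_cases h1 : G.Adj v w <;> simp [g, h1, hw]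
    simp only [Finset.sum_apply, hg, Finset.sum_sub_distrib, Finset.sum_ite_eq', Finset.mem_univ,
      if_true, Matrix.submatrix_apply, SimpleGraph.lapMatrix, Matrix.sub_apply,
      SimpleGraph.degMatrix, Matrix.diagonal_apply, SimpleGraph.adjMatrix_apply,
      SimpleGraph.degree_eq_sum_if_adj, ← Subtype.ext_iff]
    congr 1
    split_ifs <;> simp
  have hdet : ((G.lapMatrix ℝ).submatrix (Subtype.val : {v : V // v ≠ r} → V) Subtype.val).det =
      ∑ f : {v : V // v ≠ r} → V, (Matrix.of fun v => g v (f v)).det := by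
    rw [hrow]
    exact Matrix.detRowAlternating.toMultilinearMap.map_sum g
  rw [hdet, numSpanningTrees_eq_card_parent G r, Nat.card_eq_fintype_card, Fintype.card_subtype,
    Finset.card_filter]
  push_cast
  refine Finset.sum_congr rfl fun f _ => ?_
  by_cases hadj : ∀ v : {v : V // v ≠ r}, G.Adj v (f v)
  · have : (Matrix.of fun v => g v (f v)) = Matrix.of fun v j : {v : V // v ≠ r} =>
      ((if v = j then 1 else 0) - (if f v = j then 1 else 0) : ℝ) := by
      ext v j
      simp [g, hadj v]
    rw [this, det_parent]
    simp [hadj]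
  · rw [if_neg fun h => hadj h.1]
    push Not at hadj
    obtain ⟨v, hv⟩ := hadj
    refine (Matrix.det_eq_zero_of_row_eq_zero v fun j => ?_).symm
    simp [g, hv]

/-! ### Adjacency, degrees and counts in the blow-up. -/

section CliqueBlowUp

variable {n : ℕ} {V : Type u} {G : SimpleGraph V}

theorem inl_mem_edgeClique {e : G.edgeSet} {v : V} :
    Sum.inl v ∈ edgeClique n G e ↔ v ∈ (e : Sym2 V) := by
  simp [edgeClique]

theorem inr_mem_edgeClique {e : G.edgeSet} {p : G.edgeSet × Fin (n - 2)} :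
    Sum.inr p ∈ edgeClique n G e ↔ p.1 = e := by
  obtain ⟨e', i⟩ := p
  simp [edgeClique]

theorem cliqueBlowUp_adj_inl_inl {u v : V} :
    (cliqueBlowUp n G).Adj (Sum.inl u) (Sum.inl v) ↔ G.Adj u v := by
  simp only [cliqueBlowUp, inl_mem_edgeClique, ne_eq, Sum.inl.injEq]
  constructor
  · rintro ⟨hne, ⟨e, he⟩, hu, hv⟩
    obtain rfl := (Sym2.mem_and_mem_iff hne).1 ⟨hu, hv⟩
    exact he
  · intro h
    exact ⟨h.ne, ⟨s(u, v), h⟩, by simp, by simp⟩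

theorem cliqueBlowUp_adj_inl_inr {v : V} {p : G.edgeSet × Fin (n - 2)} :
    (cliqueBlowUp n G).Adj (Sum.inl v) (Sum.inr p) ↔ v ∈ (p.1 : Sym2 V) := by
  simp [cliqueBlowUp, inl_mem_edgeClique, inr_mem_edgeClique]

theorem cliqueBlowUp_adj_inr_inl {v : V} {p : G.edgeSet × Fin (n - 2)} :
    (cliqueBlowUp n G).Adj (Sum.inr p) (Sum.inl v) ↔ v ∈ (p.1 : Sym2 V) := by
  rw [SimpleGraph.adj_comm, cliqueBlowUp_adj_inl_inr]

theorem cliqueBlowUp_adj_inr_inr {p q : G.edgeSet × Fin (n - 2)} :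
    (cliqueBlowUp n G).Adj (Sum.inr p) (Sum.inr q) ↔ p ≠ q ∧ p.1 = q.1 := by
  simp only [cliqueBlowUp, inr_mem_edgeClique, ne_eq, Sum.inr.injEq]
  exact and_congr_right fun _ => ⟨fun ⟨_, h, h'⟩ => h.trans h'.symm, fun h => ⟨_, h, rfl⟩⟩

open Classical in
-- These are the entries of the incidence matrix times its transpose; they appear in the Schur
-- complement.
theorem sum_edgeSet_mem_mem [Fintype V] (u v : V) :
    ∑ e : G.edgeSet, (if u ∈ (e : Sym2 V) then (1 : ℝ) else 0) *
      (if v ∈ (e : Sym2 V) then 1 else 0) =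
      if u = v then (G.degree u : ℝ) else if G.Adj u v then 1 else 0 := by
  have h1 := congrFun (congrFun (G.incMatrix_mul_transpose (R := ℝ)) u) v
  rw [Matrix.of_apply] at h1
  rw [← h1, Matrix.mul_apply, ← Finset.sum_subset (Finset.subset_univ G.edgeFinset),
    Finset.sum_subtype G.edgeFinset (p := (· ∈ G.edgeSet)) (by simp)]
  · refine Finset.sum_congr rfl fun e _ => ?_
    simp [SimpleGraph.incMatrix_apply', SimpleGraph.incidenceSet]
  · intro e _ he
    rw [SimpleGraph.mem_edgeFinset] at he
    simp [SimpleGraph.incMatrix_apply', SimpleGraph.incidenceSet, he]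

open Classical in
theorem sum_edgeSet_mem [Fintype V] (v : V) :
    ∑ e : G.edgeSet, (if v ∈ (e : Sym2 V) then (1 : ℝ) else 0) = G.degree v := by
  have := sum_edgeSet_mem_mem (G := G) v v
  rw [if_pos rfl] at this
  rw [← this]
  exact Finset.sum_congr rfl fun e _ => by split_ifs <;> simp

open Classical in
theorem sum_mem_edge [Fintype V] (e : G.edgeSet) :
    ∑ v : V, (if v ∈ (e : Sym2 V) then (1 : ℝ) else 0) = 2 := by
  rw [← G.sum_incMatrix_apply_of_mem_edgeSet e.2]
  simp [SimpleGraph.incMatrix_apply', SimpleGraph.incidenceSet]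

open Classical in
theorem degree_cliqueBlowUp_inl [Fintype V] (hn : 2 ≤ n) (v : V) :
    ((cliqueBlowUp n G).degree (Sum.inl v) : ℝ) = (n - 1) * G.degree v := by
  have h : ∑ u : V, (if G.Adj v u then (1 : ℝ) else 0) = G.degree v :=
    (SimpleGraph.degree_eq_sum_if_adj G v).symm
  have h1 : ∀ e : G.edgeSet, ∑ i : Fin (n - 2),
      (if (cliqueBlowUp n G).Adj (Sum.inl v) (Sum.inr (e, i)) then (1 : ℝ) else 0) =
        (n - 2) * if v ∈ (e : Sym2 V) then 1 else 0 := fun e => by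
    by_cases hv : v ∈ (e : Sym2 V) <;> simp [cliqueBlowUp_adj_inl_inr, hv, Nat.cast_sub hn]
  rw [SimpleGraph.degree_eq_sum_if_adj, Fintype.sum_sum_type, Fintype.sum_prod_type,
    Finset.sum_congr rfl fun e _ => h1 e, ← Finset.mul_sum, sum_edgeSet_mem]
  simp only [cliqueBlowUp_adj_inl_inl, h]
  ring

open Classical in
theorem degree_cliqueBlowUp_inr [Fintype V] (hn : 2 ≤ n) (p : G.edgeSet × Fin (n - 2)) :
    ((cliqueBlowUp n G).degree (Sum.inr p) : ℝ) = n - 1 := by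
  obtain ⟨e, i⟩ := p
  have h : ∀ (f : G.edgeSet) (j : Fin (n - 2)), (if (e, i) ≠ (f, j) ∧ e = f then (1 : ℝ) else 0) =
      if e = f then 1 - (if i = j then 1 else 0) else 0 := by
    intro f j
    by_cases h1 : e = f <;> by_cases h2 : i = j <;> simp [h1, h2]
  rw [SimpleGraph.degree_eq_sum_if_adj]
  simp only [Fintype.sum_sum_type, Fintype.sum_prod_type, cliqueBlowUp_adj_inr_inl,
    cliqueBlowUp_adj_inr_inr, sum_mem_edge, h]
  rw [Finset.sum_comm]
  simp [Nat.cast_sub hn]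
  ring

theorem natCard_edgeSet_cliqueBlowUp [Finite V] (hn : 2 ≤ n) :
    (Nat.card (cliqueBlowUp n G).edgeSet : ℝ) = n * (n - 1) / 2 * Nat.card G.edgeSet := by
  classical
  have := Fintype.ofFinite V
  have h1 := congrArg (Nat.cast : ℕ → ℝ) G.sum_degrees_eq_twice_card_edges
  have h2 := congrArg (Nat.cast : ℕ → ℝ) (cliqueBlowUp n G).sum_degrees_eq_twice_card_edges
  push_cast at h1 h2
  rw [Fintype.sum_sum_type] at h2
  simp only [degree_cliqueBlowUp_inl hn, degree_cliqueBlowUp_inr hn, ← Finset.mul_sum, h1,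
    Finset.sum_const, Finset.card_univ, Fintype.card_prod, Fintype.card_fin, nsmul_eq_mul,
    Nat.cast_mul, Nat.cast_sub hn, SimpleGraph.edgeFinset_card] at h2
  rw [Nat.card_eq_fintype_card, Nat.card_eq_fintype_card]
  push_cast at h2
  linarith

theorem natCard_cliqueBlowUp [Finite V] (hn : 2 ≤ n) :
    (Nat.card (V ⊕ (G.edgeSet × Fin (n - 2))) : ℝ) =
      Nat.card V + (n - 2) * Nat.card G.edgeSet := by
  rw [Nat.card_sum, Nat.card_prod, Nat.card_fin]
  push_cast [Nat.cast_sub hn]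
  ring

end CliqueBlowUp

/-! ### Elimination of the new vertices. -/

section SchurComplement

open Matrix Kronecker

/-- A rank-one perturbation of a scalar matrix: the matrix determinant lemma applies. -/
theorem det_smul_one_sub_ones (m : ℕ) (c : ℝ) (hc : c ≠ 0) :
    (c • (1 : Matrix (Fin m) (Fin m) ℝ) - Matrix.of fun _ _ => 1).det = c ^ m * (1 - m / c) := by
  have h : c • (1 : Matrix (Fin m) (Fin m) ℝ) - Matrix.of (fun _ _ => 1) =
      c • ((1 : Matrix (Fin m) (Fin m) ℝ) +
        (replicateCol Unit (fun _ => -c⁻¹) : Matrix (Fin m) Unit ℝ) *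
          (replicateRow Unit (fun _ => 1) : Matrix Unit (Fin m) ℝ)) := by
    ext i j
    simp [Matrix.mul_apply, mul_add, hc, sub_eq_add_neg]
  rw [h, det_smul, det_one_add_replicateCol_mul_replicateRow]
  simp [dotProduct]
  field_simp
  simp [sub_eq_add_neg]

theorem smul_one_sub_ones_mul_inv (m : ℕ) :
    (((m : ℝ) + 2) • (1 : Matrix (Fin m) (Fin m) ℝ) - Matrix.of fun _ _ => 1) *
      (((m : ℝ) + 2)⁻¹ • (1 + (2 : ℝ)⁻¹ • Matrix.of fun _ _ => 1)) = 1 := by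
  have hJ : (Matrix.of fun _ _ => 1 : Matrix (Fin m) (Fin m) ℝ) * (Matrix.of fun _ _ => 1) =
      (m : ℝ) • Matrix.of fun _ _ => 1 := by
    ext i j
    simp [Matrix.mul_apply]
  have hm : (m : ℝ) + 2 ≠ 0 := by positivity
  generalize (Matrix.of fun _ _ => 1 : Matrix (Fin m) (Fin m) ℝ) = J at *
  rw [mul_smul_comm, sub_mul, mul_add, mul_add, mul_smul_comm, mul_smul_comm, hJ]
  simp only [mul_one, smul_mul_assoc, one_mul]
  have : ((m : ℝ) + 2) • (1 : Matrix (Fin m) (Fin m) ℝ) + (2 : ℝ)⁻¹ • (((m : ℝ) + 2) • J) -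
      (J + (2 : ℝ)⁻¹ • ((m : ℝ) • J)) = ((m : ℝ) + 2) • 1 := by module
  rw [this, smul_smul, inv_mul_cancel₀ hm, one_smul]

end SchurComplement

open Matrix Kronecker in
/-- Eliminating the new vertices from the reduced Laplacian of `CL(G)` leaves `n / 2` times the
reduced Laplacian of `G`. -/
theorem det_lapMatrix_cliqueBlowUp {n : ℕ} (hn : 3 ≤ n) {V : Type u} [Fintype V] [DecidableEq V]
    (G : SimpleGraph V) [DecidableRel G.Adj] [Fintype G.edgeSet] [DecidableEq G.edgeSet]
    [DecidableRel (cliqueBlowUp n G).Adj] (r : V) :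
    (((cliqueBlowUp n G).lapMatrix ℝ).submatrix
      (Subtype.val : {x : V ⊕ (G.edgeSet × Fin (n - 2)) // x ≠ Sum.inl r} → _)
      Subtype.val).det =
    ((n : ℝ) ^ (n - 2) * (2 / n)) ^ Fintype.card G.edgeSet * ((n / 2 : ℝ) ^ (Fintype.card V - 1) *
      ((G.lapMatrix ℝ).submatrix (Subtype.val : {v : V // v ≠ r} → V) Subtype.val).det) := by
  classical
  have hn0 : (n : ℝ) ≠ 0 := by positivity
  have hm : ((n - 2 : ℕ) : ℝ) + 2 = n := by
    rw [Nat.cast_sub (by omega)]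
    push_cast
    ring
  let φ : {v : V // v ≠ r} ⊕ (G.edgeSet × Fin (n - 2)) ≃
      {x : V ⊕ (G.edgeSet × Fin (n - 2)) // x ≠ Sum.inl r} := Equiv.ofBijective
    (Sum.elim (fun v => ⟨Sum.inl v.1, fun h => v.2 (Sum.inl_injective h)⟩)
      (fun p => ⟨Sum.inr p, Sum.inr_ne_inl⟩)) (by
      constructor
      · rintro (⟨a, ha⟩ | a) (⟨b, hb⟩ | b) h <;> simp_all
      · rintro ⟨a | a, ha⟩
        · exact ⟨Sum.inl ⟨a, fun h => ha (by rw [h])⟩, rfl⟩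
        · exact ⟨Sum.inr a, rfl⟩)
  have hφl : ∀ v : {v : V // v ≠ r},
      (φ (Sum.inl v) : V ⊕ (G.edgeSet × Fin (n - 2))) = Sum.inl (v : V) := fun _ => rfl
  have hφr : ∀ p : (G.edgeSet × Fin (n - 2)),
      (φ (Sum.inr p) : V ⊕ (G.edgeSet × Fin (n - 2))) = Sum.inr p := fun _ => rfl
  let A : Matrix {v : V // v ≠ r} {v : V // v ≠ r} ℝ := Matrix.of fun u v =>
    (if u = v then ((n : ℝ) - 1) * G.degree u else 0) - if G.Adj u v then 1 else 0
  let B : Matrix {v : V // v ≠ r} (G.edgeSet × Fin (n - 2)) ℝ :=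
    Matrix.of fun v p => -if (v : V) ∈ (p.1 : Sym2 V) then 1 else 0
  let M : Matrix (Fin (n - 2)) (Fin (n - 2)) ℝ := (n : ℝ) • 1 - Matrix.of fun _ _ => 1
  let M' : Matrix (Fin (n - 2)) (Fin (n - 2)) ℝ :=
    (n : ℝ)⁻¹ • (1 + (2 : ℝ)⁻¹ • Matrix.of fun _ _ => 1)
  let D : Matrix (G.edgeSet × Fin (n - 2)) (G.edgeSet × Fin (n - 2)) ℝ :=
    (1 : Matrix G.edgeSet G.edgeSet ℝ) ⊗ₖ M
  let D' : Matrix (G.edgeSet × Fin (n - 2)) (G.edgeSet × Fin (n - 2)) ℝ :=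
    (1 : Matrix G.edgeSet G.edgeSet ℝ) ⊗ₖ M'
  have hM : M * M' = 1 := by
    have := smul_one_sub_ones_mul_inv (n - 2)
    rwa [hm] at this
  have hD : D * D' = 1 := by
    rw [← mul_kronecker_mul, hM, mul_one, one_kronecker_one]
  have hblocks : (((cliqueBlowUp n G).lapMatrix ℝ).submatrix
      (Subtype.val : {x : V ⊕ (G.edgeSet × Fin (n - 2)) // x ≠ Sum.inl r} → _) Subtype.val).submatrix
        φ φ =
      fromBlocks A B Bᵀ D := by
    ext (u | ⟨e, i⟩) (v | ⟨f, j⟩)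
    · have hdeg : ((cliqueBlowUp n G).degree (Sum.inl (u : V)) : ℝ) = (n - 1) * G.degree (u : V) := by
        convert degree_cliqueBlowUp_inl (G := G) (show 2 ≤ n by omega) (u : V)
      simp only [submatrix_apply, hφl, hdeg, SimpleGraph.lapMatrix, SimpleGraph.degMatrix,
        SimpleGraph.adjMatrix_apply, Matrix.sub_apply, Matrix.diagonal_apply,
        fromBlocks_apply₁₁, A, of_apply, Sum.inl.injEq, cliqueBlowUp_adj_inl_inl, ← Subtype.ext_iff]
    · simp [hφl, hφr, SimpleGraph.lapMatrix, SimpleGraph.degMatrix, B, cliqueBlowUp_adj_inl_inr]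
    · simp [hφl, hφr, SimpleGraph.lapMatrix, SimpleGraph.degMatrix, B, cliqueBlowUp_adj_inr_inl]
    · have hdeg : ((cliqueBlowUp n G).degree (Sum.inr (e, i)) : ℝ) = n - 1 := by
        convert degree_cliqueBlowUp_inr (G := G) (by omega) (e, i)
      simp only [submatrix_apply, hφr, SimpleGraph.lapMatrix, SimpleGraph.degMatrix,
        SimpleGraph.adjMatrix_apply, Matrix.sub_apply, Matrix.diagonal_apply, hdeg,
        fromBlocks_apply₂₂, D, kroneckerMap_apply, M, of_apply, Sum.inr.injEq,
        cliqueBlowUp_adj_inr_inr, Matrix.one_apply, Matrix.smul_apply]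
      by_cases h1 : e = f <;> by_cases h2 : i = j <;> simp [h1, h2]
  -- Rows of `B` are constant on each edge's new vertices, so only the total entry sum of `M'`
  -- enters `B * D' * Bᵀ`.
  have hsum : ∑ j, ∑ i, M' i j = ((n : ℝ) - 2) / 2 := by
    simp [M', Matrix.one_apply, Finset.sum_add_distrib,
      Nat.cast_sub (show 2 ≤ n by omega)]
    field_simp
    ring
  have hschur : A - B * D' * Bᵀ =
      (n / 2 : ℝ) • (G.lapMatrix ℝ).submatrix (Subtype.val : {v : V // v ≠ r} → V) Subtype.val := by
    ext u v
    have h1 : (B * D' * Bᵀ) u v = ((n : ℝ) - 2) / 2 *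
        if (u : V) = v then (G.degree (u : V) : ℝ) else if G.Adj u v then 1 else 0 := by
      have h2 := sum_edgeSet_mem_mem (G := G) (u : V) v
      have h3 : (if (u : V) = v then (G.degree (u : V) : ℝ) else if G.Adj u v then 1 else 0) =
          ∑ e : G.edgeSet, (if (u : V) ∈ (e : Sym2 V) then (1 : ℝ) else 0) *
            (if (v : V) ∈ (e : Sym2 V) then 1 else 0) := by
        convert h2.symm
      have h4 : ∀ f j, (B * D') u (f, j) =
          -(if (u : V) ∈ (f : Sym2 V) then 1 else 0) * ∑ i, M' i j := by
        intro f j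
        simp only [Matrix.mul_apply, Fintype.sum_prod_type, D', kroneckerMap_apply,
          Matrix.one_apply, B, of_apply, ite_mul, one_mul, zero_mul, mul_ite, mul_zero]
        rw [Finset.sum_comm, Finset.mul_sum]
        simp
      rw [h3, ← hsum, mul_comm, Finset.sum_mul, Matrix.mul_apply, Fintype.sum_prod_type]
      refine Finset.sum_congr rfl fun f _ => ?_
      rw [Finset.mul_sum]
      refine Finset.sum_congr rfl fun j _ => ?_
      rw [h4, transpose_apply]
      simp only [B, of_apply]
      ring
    rw [Matrix.sub_apply, h1]
    by_cases huv : u = v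
    · subst huv
      simp [A, SimpleGraph.lapMatrix, SimpleGraph.degMatrix]
      ring
    · have huv' : (u : V) ≠ v := fun h => huv (Subtype.ext h)
      by_cases hadj : G.Adj u v <;>
        simp [A, SimpleGraph.lapMatrix, SimpleGraph.degMatrix, huv, huv', hadj]
      ring
  let _ : Invertible D := invertibleOfRightInverse D D' hD
  have hinv : ⅟D = D' := invOf_eq_right_inv hD
  rw [← det_submatrix_equiv_self φ, hblocks, det_fromBlocks₂₂, hinv, hschur, det_smul]
  congr 1
  · have := det_smul_one_sub_ones (n - 2) (n : ℝ) hn0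
    rw [det_kronecker, det_one, one_pow, one_mul, this]
    congr 2
    rw [Nat.cast_sub (by omega)]
    field_simp
    push_cast
    ring
  · congr 2
    simp [Fintype.card_subtype_compl]

/-- The number of spanning trees of `CL(G)`; connectedness of `G` is not needed. -/
theorem numSpanningTrees_cliqueBlowUp {n : ℕ} (hn : 3 ≤ n) {V : Type u} [Finite V] [Nonempty V]
    (G : SimpleGraph V) :
    (numSpanningTrees (cliqueBlowUp n G) : ℝ) =
      (2 : ℝ) ^ ((Nat.card G.edgeSet : ℤ) - (Nat.card V : ℤ) + 1) *
        (n : ℝ) ^ (((n : ℤ) - 3) * (Nat.card G.edgeSet : ℤ) + (Nat.card V : ℤ) - 1) *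
        (numSpanningTrees G : ℝ) := by
  classical
  have := Fintype.ofFinite V
  obtain ⟨r⟩ := ‹Nonempty V›
  have hn0 : (n : ℝ) ≠ 0 := by positivity
  rw [numSpanningTrees_eq_det _ (Sum.inl r), det_lapMatrix_cliqueBlowUp hn,
    ← numSpanningTrees_eq_det, ← mul_assoc, ← Nat.card_eq_fintype_card,
    ← Nat.card_eq_fintype_card]
  congr 1
  -- With `n = k + 3` and `|V| = M + 1`, the exponent of `n` is a natural number.
  obtain ⟨k, rfl⟩ := Nat.exists_eq_add_of_le' hn
  obtain ⟨M, hM⟩ := Nat.exists_eq_succ_of_ne_zero (Nat.card_pos (α := V)).ne'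
  generalize Nat.card G.edgeSet = E
  have h1 : ((k + 3 : ℕ) : ℝ) ^ (k + 3 - 2) * (2 / (k + 3 : ℕ)) = 2 * ((k + 3 : ℕ) : ℝ) ^ k := by
    rw [show k + 3 - 2 = k + 1 by omega, pow_succ]
    field_simp
  have h2 : (E : ℤ) - (M.succ : ℤ) + 1 = (E : ℤ) - (M : ℤ) := by push_cast; ring
  have h3 : (((k + 3 : ℕ) : ℤ) - 3) * (E : ℤ) + (M.succ : ℤ) - 1 = ((k * E + M : ℕ) : ℤ) := by
    push_cast; ring
  rw [h1, hM, h2, h3, zpow_sub₀ two_ne_zero, zpow_natCast, zpow_natCast, zpow_natCast, mul_pow,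
    div_pow, pow_add, pow_mul, Nat.succ_sub_one]
  field_simp

theorem numSpanningTrees_cliqueBlowUp_rpow {n : ℕ} (hn : 3 ≤ n) {V : Type u} [Finite V]
    [Nonempty V] (G : SimpleGraph V) :
    (numSpanningTrees (cliqueBlowUp n G) : ℝ) =
      (2 : ℝ) ^ ((Nat.card G.edgeSet : ℝ) - Nat.card V + 1) *
        (n : ℝ) ^ (((n : ℝ) - 3) * Nat.card G.edgeSet + Nat.card V - 1) *
        (numSpanningTrees G : ℝ) := by
  rw [numSpanningTrees_cliqueBlowUp hn, ← Real.rpow_intCast, ← Real.rpow_intCast]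
  push_cast
  rfl

/-! ### Iteration. -/

section Iterate

variable {n : ℕ} {V : Type u}

instance finite_iterCliqueBlowUp [Finite V] (G : SimpleGraph V) (r : ℕ) :
    Finite (iterCliqueBlowUp n G r).1 := by
  induction r with
  | zero => assumption
  | succ r ih =>
    exact inferInstanceAs (Finite ((iterCliqueBlowUp n G r).1 ⊕
      ((iterCliqueBlowUp n G r).2.edgeSet × Fin (n - 2))))

instance nonempty_iterCliqueBlowUp [Nonempty V] (G : SimpleGraph V) (r : ℕ) :
    Nonempty (iterCliqueBlowUp n G r).1 := by
  induction r with
  | zero => assumption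
  | succ r ih =>
    exact inferInstanceAs (Nonempty ((iterCliqueBlowUp n G r).1 ⊕
      ((iterCliqueBlowUp n G r).2.edgeSet × Fin (n - 2))))

/-- The number `(n ^ r * (n - 1) ^ r / 2 ^ r - 1) / (n ^ 2 - n - 2)`: half the sum of the first
`r` powers of `n * (n - 1) / 2`. -/
noncomputable def cliqueGrowth (n r : ℕ) : ℝ :=
  ((n : ℝ) ^ r * ((n : ℝ) - 1) ^ r / 2 ^ r - 1) / ((n : ℝ) ^ 2 - (n : ℝ) - 2)

theorem cliqueGrowth_zero : cliqueGrowth n 0 = 0 := by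
  simp [cliqueGrowth]

theorem sq_sub_sub_two_ne_zero (hn : 3 ≤ n) : (n : ℝ) ^ 2 - n - 2 ≠ 0 := by
  have : (3 : ℝ) ≤ n := by exact_mod_cast hn
  nlinarith

/-- Since `(n ^ 2 - n - 2) + 2 = n * (n - 1)`, the bracket is `(n * (n - 1) / 2) ^ r`, the factor by
which the edge number has grown. -/
theorem cliqueGrowth_succ (hn : 3 ≤ n) (r : ℕ) :
    cliqueGrowth n (r + 1) =
      cliqueGrowth n r + (1 + ((n : ℝ) ^ 2 - n - 2) * cliqueGrowth n r) / 2 := by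
  have h := sq_sub_sub_two_ne_zero hn
  have e : (n : ℝ) ^ (r + 1) * ((n : ℝ) - 1) ^ (r + 1) / 2 ^ (r + 1) =
      (n : ℝ) ^ r * ((n : ℝ) - 1) ^ r / 2 ^ r * ((((n : ℝ) ^ 2 - n - 2) + 2) / 2) := by
    rw [pow_succ, pow_succ, pow_succ]
    field_simp
    ring
  rw [cliqueGrowth, cliqueGrowth, mul_div_cancel₀ _ h, e]
  generalize (n : ℝ) ^ 2 - n - 2 = Q at h
  generalize (n : ℝ) ^ r * ((n : ℝ) - 1) ^ r / 2 ^ r = x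
  field_simp
  ring

theorem natCard_edgeSet_iterCliqueBlowUp [Finite V] (hn : 3 ≤ n) (G : SimpleGraph V) (r : ℕ) :
    (Nat.card (iterCliqueBlowUp n G r).2.edgeSet : ℝ) =
      (1 + ((n : ℝ) ^ 2 - n - 2) * cliqueGrowth n r) * Nat.card G.edgeSet := by
  induction r with
  | zero => simp [cliqueGrowth_zero, iterCliqueBlowUp]
  | succ r ih =>
    rw [cliqueGrowth_succ hn, iterCliqueBlowUp, natCard_edgeSet_cliqueBlowUp (by omega), ih]
    ring

theorem natCard_iterCliqueBlowUp [Finite V] (hn : 3 ≤ n) (G : SimpleGraph V) (r : ℕ) :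
    (Nat.card (iterCliqueBlowUp n G r).1 : ℝ) =
      Nat.card V + 2 * ((n : ℝ) - 2) * Nat.card G.edgeSet * cliqueGrowth n r := by
  induction r with
  | zero => simp [cliqueGrowth_zero, iterCliqueBlowUp]
  | succ r ih =>
    rw [cliqueGrowth_succ hn, iterCliqueBlowUp, natCard_cliqueBlowUp (by omega), ih,
      natCard_edgeSet_iterCliqueBlowUp hn]
    ring

theorem numSpanningTrees_iterCliqueBlowUp [Finite V] [Nonempty V] (hn : 3 ≤ n)
    (G : SimpleGraph V) (r : ℕ) :
    (numSpanningTrees (iterCliqueBlowUp n G r).2 : ℝ) =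
      (2 : ℝ) ^ (2 * (Nat.card G.edgeSet : ℝ) * cliqueGrowth n r - (r : ℝ) * (Nat.card V : ℝ)
          - 2 * (Nat.card G.edgeSet : ℝ) / ((n : ℝ) + 1) * (2 * cliqueGrowth n r - (r : ℝ))
          + (r : ℝ)) *
      (n : ℝ) ^ (2 * ((n : ℝ) - 3) * (Nat.card G.edgeSet : ℝ) * cliqueGrowth n r
          + (r : ℝ) * (Nat.card V : ℝ)
          + 2 * (Nat.card G.edgeSet : ℝ) / ((n : ℝ) + 1) * (2 * cliqueGrowth n r - (r : ℝ))
          - (r : ℝ)) *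
      (numSpanningTrees G : ℝ) := by
  induction r with
  | zero => simp [cliqueGrowth_zero, iterCliqueBlowUp]
  | succ r ih =>
    have hn0 : (0 : ℝ) < n := by positivity
    rw [iterCliqueBlowUp, numSpanningTrees_cliqueBlowUp_rpow hn, ih, ← mul_assoc,
      mul_mul_mul_comm, ← Real.rpow_add two_pos, ← Real.rpow_add hn0,
      natCard_edgeSet_iterCliqueBlowUp hn, natCard_iterCliqueBlowUp hn, cliqueGrowth_succ hn]
    -- Both exponents match because `n ^ 2 - n - 2 = (n - 2) * (n + 1)`, which cancels the
    -- denominator `n + 1`.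
    congr 3
    · push_cast
      field_simp
      ring
    · push_cast
      field_simp
      ring

end Iterate

theorem mainTheorem5 {V : Type u} [Finite V] (G : SimpleGraph V) (hG : G.Connected)
    (N₀ E₀ : ℕ) (hN₀ : N₀ = Nat.card V) (hE₀ : E₀ = Nat.card G.edgeSet)
    (n : ℕ) (hn : 3 ≤ n) :
    ((numSpanningTrees (cliqueBlowUp n G) : ℝ) =
      (2 : ℝ) ^ ((E₀ : ℤ) - (N₀ : ℤ) + 1) *
        (n : ℝ) ^ (((n : ℤ) - 3) * (E₀ : ℤ) + (N₀ : ℤ) - 1) * (numSpanningTrees G : ℝ)) ∧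
    (∀ (r : ℕ), 1 ≤ r → ∀ α : ℝ,
      α = ((n : ℝ) ^ r * ((n : ℝ) - 1) ^ r / 2 ^ r - 1) / ((n : ℝ) ^ 2 - (n : ℝ) - 2) →
      (numSpanningTrees (iterCliqueBlowUp n G r).2 : ℝ) =
        (2 : ℝ) ^ (2 * (E₀ : ℝ) * α - (r : ℝ) * (N₀ : ℝ)
            - 2 * (E₀ : ℝ) / ((n : ℝ) + 1) * (2 * α - (r : ℝ)) + (r : ℝ)) *
        (n : ℝ) ^ (2 * ((n : ℝ) - 3) * (E₀ : ℝ) * α + (r : ℝ) * (N₀ : ℝ)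
            + 2 * (E₀ : ℝ) / ((n : ℝ) + 1) * (2 * α - (r : ℝ)) - (r : ℝ)) *
        (numSpanningTrees G : ℝ)) := by
  subst hN₀ hE₀
  have := hG.nonempty
  refine ⟨numSpanningTrees_cliqueBlowUp hn G, ?_⟩
  rintro r - α rfl
  exact numSpanningTrees_iterCliqueBlowUp hn G r
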